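/- Let $F\colon\mathbb R^n\rightrightarrows\mathbb R^m$ and $G\colon\mathbb R^n\times\mathbb R^m\rightrightarrows\mathbb R^s$ be set-valued mappings with closed graphs, let $M\subset\mathbb R^n$ be nonempty and closed, and let $f\colon\mathbb R^n\to\mathbb R$ be locally Lipschitz continuous. Consider the problem of minimizing $f(z)$ over $z\in\mathbb R^n$ subject to $0\in H(z)$ and $z\in M$, where $H(z):=\bigcup_{\lambda\in F(z)}G(z,\lambda)$, and put $K(z):=\{\lambda\in F(z)\mid 0\in G(z,\lambda)\}$. For a set $A$ and $\bar x\in A$, let $\mathcal T_A(\bar x)$ be the set of all limits of $(x_k-\bar x)/t_k$ with $x_k\in A$, $x_k\to\bar x$, $t_k\downarrow 0$; let $\widehat{\mathcal N}_A(\bar x):=\{\xi\mid \xi^\top d\le 0\ \forall d\in\mathcal T_A(\bar x)\}$; and let $\mathcal N_A(\bar x)$ be the limiting normal cone, i.e. the set of all limits of sequences $\xi_k\in\widehat{\mathcal N}_A(x_k)$ with $x_k\in A$, $x_k\to\bar x$. Let $\partial f(\bar z):=\{\xi\mid(\xi,-1)\in\mathcal N_{\operatorname{epi}f}(\bar z,f(\bar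 z))\}$ be the limiting subdifferential and, for a set-valued mapping $\Upsilon$ and $\bar y\in\Upsilon(\bar x)$, let $D^*\Upsilon(\bar x,\bar y)(\eta):=\{\xi\mid(\xi,-\eta)\in\mathcal N_{\operatorname{gph}\Upsilon}(\bar x,\bar y)\}$ be the limiting coderivative. A feasible point $\bar z$ (that is, $\bar z\in M$ and $0\in H(\bar z)$) is called *implicitly M-stationary* if there is $\nu\in\mathbb R^s$ with $$0\in\partial f(\bar z)+D^*H(\bar z,0)(\nu)+\mathcal N_M(\bar z),$$ and *explicitly M-stationary* if there are $\bar\lambda\in K(\bar z)$, $\mu\in\mathbb R^m$ and $\nu\in\mathbb R^s$ with $$0\in\partial f(\bar z)+D^*F(\bar z,\bar\lambda)(\mu)+\{\xi\in\mathbb R^n\mid(\xi,\mu)\in D^*G((\bar z,\bar\lambda),0)(\nu)\}+\mathcal N_M(\bar z).$$ A set-valued mapping $\Upsilon$ is *inner semicompact at $\bar x$ with respect to $\Omega$* if for every sequence $x_k\to\bar x$ in $\Omega$ there are a subsequence $(x_{k_l})_l$ and a convergent sequence $(y_l)_l$ with $y_l\in\Upsilon(x_{k_l})$ for all $l$. It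 is *metrically subregular at $(\bar x,\bar y)$*, where $\bar y\in\Upsilon(\bar x)$, if there are $\kappa>0$ and a neighborhood $U$ of $\bar x$ with $\operatorname{dist}(x,\Upsilon^{-1}(\bar y))\le\kappa\operatorname{dist}(\bar y,\Upsilon(x))$ for all $x\in U$, where $\operatorname{dist}(\cdot,\varnothing)=\infty$. **Proposition.** Let $\bar z\in\mathbb R^n$ be implicitly M-stationary. Suppose that the mapping $$(z,w)\rightrightarrows\{(z,\lambda)\mid\lambda\in F(z),\ w\in G(z,\lambda)\}$$ on $\mathbb R^n\times\mathbb R^s$ is inner semicompact at $(\bar z,0)$ with respect to its domain (the set of all $(z,w)$ at which its value is nonempty), and that the mapping $$(z,w,q,\lambda)\rightrightarrows\bigl(z-q,\ F(z)-\lambda,\ G(q,\lambda)-w\bigr)$$ from $\mathbb R^n\times\mathbb R^s\times\mathbb R^n\times\mathbb R^m$ to $\mathbb R^n\times\mathbb R^m\times\mathbb R^s$ is metrically subregular at $((\bar z,0,\bar z,\lambda),(0,0,0))$ for every $\lambda\in K(\bar z)$. Then $\bar z$ is explicitly M-stationary. -/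

import Mathlib

open Filter Topology
open scoped Pointwise

namespace ImplicitVar

/-- The Euclidean product of two spaces: for `X = ℝⁿ` and `Y = ℝᵐ` this is `ℝⁿ × ℝᵐ = ℝⁿ⁺ᵐ` with
its usual inner product. All properties below that refer to norms or to convergence do not change
if the norm of the product is replaced by an equivalent one, such as the sum of the norms. -/
abbrev EProd (X Y : Type*) : Type _ := WithLp 2 (X × Y)

infixr:35 " ×ₑ " => EProd

/-- The pair `(x, y)` as an element of the Euclidean product. -/
def pair {X Y : Type*} (x : X) (y : Y) : X ×ₑ Y := WithLp.toLp 2 (x, y)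

/-! ### Set-valued mappings -/

section SetValued

/-- The graph of the set-valued mapping `Υ`. -/
def gph {X Y : Type*} (Υ : X → Set Y) : Set (X ×ₑ Y) :=
  {p | p.snd ∈ Υ p.fst}

/-- The domain of the set-valued mapping `Υ`. -/
def dom {X Y : Type*} (Υ : X → Set Y) : Set X :=
  {x | (Υ x).Nonempty}

/-- The inverse of the set-valued mapping `Υ`. -/
def inv {X Y : Type*} (Υ : X → Set Y) : Y → Set X :=
  fun y => {x | y ∈ Υ x}

/-- `Υ` is inner semicompact at `x` with respect to `Ω`: each sequence in `Ω` converging to `x`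
has a subsequence along which one can select from `Υ` a convergent sequence. -/
def InnerSemicompactAt {X Y : Type*} [TopologicalSpace X] [TopologicalSpace Y]
    (Υ : X → Set Y) (x : X) (Ω : Set X) : Prop :=
  ∀ u : ℕ → X, (∀ k, u k ∈ Ω) → Tendsto u atTop (𝓝 x) →
    ∃ (φ : ℕ → ℕ) (y : ℕ → Y) (y₀ : Y), StrictMono φ ∧ Tendsto y atTop (𝓝 y₀) ∧
      ∀ l, y l ∈ Υ (u (φ l))

/-- `Υ` is metrically subregular at `(x, y)`: for some `κ > 0` and all `x'` near `x`,
`dist (x', Υ⁻¹(y)) ≤ κ dist (y, Υ(x'))`. The distance to the empty set is `∞`. -/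
def MetricallySubregularAt {X Y : Type*} [PseudoEMetricSpace X] [PseudoEMetricSpace Y]
    (Υ : X → Set Y) (x : X) (y : Y) : Prop :=
  ∃ κ : NNReal, 0 < κ ∧ ∃ U ∈ 𝓝 x, ∀ x' ∈ U,
    Metric.infEDist x' (inv Υ y) ≤ (κ : ENNReal) * Metric.infEDist y (Υ x')

end SetValued

/-! ### Generalized differentiation -/

section Variational

variable {X Y : Type*} [NormedAddCommGroup X] [InnerProductSpace ℝ X]
  [NormedAddCommGroup Y] [InnerProductSpace ℝ Y]

/-- The Bouligand tangent cone to `A` at `x`. -/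
def tangentCone (A : Set X) (x : X) : Set X :=
  {d | ∃ (u : ℕ → X) (t : ℕ → ℝ), (∀ k, u k ∈ A) ∧ (∀ k, 0 < t k) ∧
    Tendsto u atTop (𝓝 x) ∧ Tendsto t atTop (𝓝 0) ∧
    Tendsto (fun k => (t k)⁻¹ • (u k - x)) atTop (𝓝 d)}

/-- The regular (Fréchet) normal cone: the polar cone of the tangent cone. -/
def regularNormalCone (A : Set X) (x : X) : Set X :=
  {ξ | ∀ d ∈ tangentCone A x, inner ℝ ξ d ≤ 0}

/-- The limiting (Mordukhovich) normal cone. -/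
def limitingNormalCone (A : Set X) (x : X) : Set X :=
  {ξ | ∃ (u : ℕ → X) (v : ℕ → X), (∀ k, u k ∈ A) ∧ Tendsto u atTop (𝓝 x) ∧
    Tendsto v atTop (𝓝 ξ) ∧ ∀ k, v k ∈ regularNormalCone A (u k)}

/-- The epigraph of `f`. -/
def epigraph (f : X → ℝ) : Set (X ×ₑ ℝ) :=
  {p | f p.fst ≤ p.snd}

/-- The limiting subdifferential of `f` at `x`. -/
def limitingSubdifferential (f : X → ℝ) (x : X) : Set X :=
  {ξ | pair ξ (-1 : ℝ) ∈ limitingNormalCone (epigraph f) (pair x (f x))}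

/-- The limiting coderivative `D*Υ(x, y)`, a set-valued mapping from `Y` to `X`. -/
def coderivative (Υ : X → Set Y) (x : X) (y : Y) : Y → Set X :=
  fun η => {ξ | pair ξ (-η) ∈ limitingNormalCone (gph Υ) (pair x y)}

end Variational

/-! ### The problem with implicit variables

Minimize `f z` subject to `0 ∈ H z` and `z ∈ M`, where `H z = ⋃_{l ∈ F z} G (z, l)`. -/

section Problem

/-- The constraint mapping `H z = ⋃_{l ∈ F z} G (z, l)`. -/
def constraintMap {X Y W : Type*} (F : X → Set Y) (G : X ×ₑ Y → Set W) : X → Set W :=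
  fun z => ⋃ l ∈ F z, G (pair z l)

/-- The mapping `K z = {l ∈ F z | 0 ∈ G (z, l)}`. -/
def multiplierMap {X Y W : Type*} [Zero W] (F : X → Set Y) (G : X ×ₑ Y → Set W) : X → Set Y :=
  fun z => {l | l ∈ F z ∧ 0 ∈ G (pair z l)}

/-- The feasible set `Z = {z ∈ M | 0 ∈ H z}`. -/
def feasibleSet {X Y W : Type*} [Zero W] (F : X → Set Y) (G : X ×ₑ Y → Set W) (M : Set X) :
    Set X :=
  {z | 0 ∈ constraintMap F G z ∧ z ∈ M}

/-- The intermediate mapping `(z, w) ↦ {(z, l) | l ∈ F z, w ∈ G (z, l)}`. -/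
def intermediateMap {X Y W : Type*} (F : X → Set Y) (G : X ×ₑ Y → Set W) :
    X ×ₑ W → Set (X ×ₑ Y) :=
  fun p => {r | ∃ l ∈ F p.fst, p.snd ∈ G (pair p.fst l) ∧ r = pair p.fst l}

/-- The feasibility mapping `(z, w, q, l) ↦ (z - q, F z - l, G (q, l) - w)`. -/
def feasibilityMap {X Y W : Type*} [AddGroup X] [AddGroup Y] [AddGroup W]
    (F : X → Set Y) (G : X ×ₑ Y → Set W) :
    X ×ₑ W ×ₑ X ×ₑ Y → Set (X ×ₑ Y ×ₑ W) :=
  fun p =>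
    let z := p.fst
    let w := p.snd.fst
    let q := p.snd.snd.fst
    let l := p.snd.snd.snd
    {r | ∃ y ∈ F z, ∃ g ∈ G (pair q l), r = pair (z - q) (pair (y - l) (g - w))}

variable {X Y W : Type*} [NormedAddCommGroup X] [InnerProductSpace ℝ X]
  [NormedAddCommGroup Y] [InnerProductSpace ℝ Y]
  [NormedAddCommGroup W] [InnerProductSpace ℝ W]

/-- `z` is implicitly M-stationary: `z` is feasible and, for some `ν`,
`0 ∈ ∂f(z) + D*H(z, 0)(ν) + N_M(z)`. -/
def ImplicitlyMStationary (f : X → ℝ) (F : X → Set Y) (G : X ×ₑ Y → Set W) (M : Set X)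
    (z : X) : Prop :=
  z ∈ feasibleSet F G M ∧
  ∃ ν : W, (0 : X) ∈ limitingSubdifferential f z
    + coderivative (constraintMap F G) z 0 ν + limitingNormalCone M z

/-- `z` is explicitly M-stationary: `z` is feasible and, for some `l ∈ K z`, `μ` and `ν`,
`0 ∈ ∂f(z) + D*F(z, l)(μ) + {ξ | (ξ, μ) ∈ D*G((z, l), 0)(ν)} + N_M(z)`. -/
def ExplicitlyMStationary (f : X → ℝ) (F : X → Set Y) (G : X ×ₑ Y → Set W) (M : Set X)
    (z : X) : Prop :=
  z ∈ feasibleSet F G M ∧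
  ∃ l ∈ multiplierMap F G z, ∃ (μ : Y) (ν : W), (0 : X) ∈ limitingSubdifferential f z
    + coderivative F z l μ + {ξ : X | pair ξ μ ∈ coderivative G (pair z l) 0 ν}
    + limitingNormalCone M z

end Problem

end ImplicitVar

/-! The set of all `(z, w, q, λ)` with `q = z`, `λ ∈ F z`, `w ∈ G (q, λ)` projects onto the graph of
`H`, so a regular normal `(ξ, ω)` to that graph lifts to this set with zero in the block `(q, λ)`.
For `(z, y) ∈ gph F` and `((q, λ), w) ∈ gph G`, metric subregularity bounds the distance to the set
by `κ` times the mismatch `(z, y) - (q, λ)`. The two graphs can therefore be decoupled by an exact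
penalty, and minimizing a smoothed version gives `u` with `‖u‖ ≤ κ‖(ξ, ω)‖` such that `(ξ, 0) - u`
and `(u, ω)` are, up to small errors, regular normals to the two graphs at nearby points
(`exists_approximate_normals`). Inner semicompactness makes the intermediate `λ` subconverge and the
bound does the same for `u`; `exists_multiplier` passes to the limit. Only the coderivative of `H`
is split; the other terms of the stationarity condition stay as they are. -/

namespace ImplicitVar

/-! ### Regular normals and a smoothed penalty principle. -/

section NormalCones

variable {X V : Type*} [NormedAddCommGroup X] [InnerProductSpace ℝ X]
  [NormedAddCommGroup V] [InnerProductSpace ℝ V]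

theorem tangentCone_subset_posTangentConeAt (S : Set X) (x : X) :
    tangentCone S x ⊆ posTangentConeAt S x := by
  rintro d ⟨u, t, hu, ht, hux, -, hd⟩
  refine mem_tangentConeAt_of_seq atTop (fun k => (⟨(t k)⁻¹, (inv_pos.2 (ht k)).le⟩ : NNReal))
    (fun k => u k - x) ?_ ?_ ?_
  · simpa using hux.sub_const x
  · exact Eventually.of_forall fun k => by simpa using hu k
  · exact hd

/-- In finite dimensions the elements of the polar of the tangent cone are Fréchet normals. -/
theorem exists_inner_le_of_mem_regularNormalCone [FiniteDimensional ℝ X] {S : Set X} {p ξ : X}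
    (h : ξ ∈ regularNormalCone S p) {ε : ℝ} (hε : 0 < ε) :
    ∃ δ > 0, ∀ x ∈ S, ‖x - p‖ < δ → inner ℝ ξ (x - p) ≤ ε * ‖x - p‖ := by
  by_contra! hcon
  choose x hxS hxp hx using fun k : ℕ => hcon (1 / ((k : ℝ) + 1)) Nat.one_div_pos_of_nat
  have hpos : ∀ k, 0 < ‖x k - p‖ := fun k => by
    rw [norm_pos_iff]
    intro h0
    have := hx k
    simp [h0] at this
  have hsph : ∀ k, ‖x k - p‖⁻¹ • (x k - p) ∈ Metric.sphere (0 : X) 1 := fun k => by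
    simp [norm_smul, inv_mul_cancel₀ (hpos k).ne']
  obtain ⟨d, -, φ, hφ, hd⟩ := (isCompact_sphere (0 : X) 1).tendsto_subseq hsph
  have h0 : Tendsto (fun k => ‖x k - p‖) atTop (𝓝 0) :=
    squeeze_zero (fun k => norm_nonneg _) (fun k => (hxp k).le)
      tendsto_one_div_add_atTop_nhds_zero_nat
  -- The distances to `p` serve as step sizes, so the limit of the unit directions is tangent.
  have hdT : d ∈ tangentCone S p :=
    ⟨x ∘ φ, fun k => ‖x (φ k) - p‖, fun k => hxS _, fun k => hpos _,
      (tendsto_iff_norm_sub_tendsto_zero.2 h0).comp hφ.tendsto_atTop,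
      h0.comp hφ.tendsto_atTop, hd⟩
  have hge : ε ≤ inner ℝ ξ d := by
    refine ge_of_tendsto ((tendsto_const_nhds (x := ξ)).inner hd) (Eventually.of_forall fun k => ?_)
    simp only [Function.comp, inner_smul_right]
    rw [inv_mul_eq_div, le_div_iff₀ (hpos _)]
    exact (hx _).le
  linarith [h d hdT]

/-- A regular normal is, up to first order, exactly penalized by the distance function. -/
theorem exists_inner_le_infDist_of_mem_regularNormalCone [FiniteDimensional ℝ X] {S : Set X}
    (hS : IsClosed S) {p ξ : X} (hp : p ∈ S) (h : ξ ∈ regularNormalCone S p)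
    {ε : ℝ} (hε : 0 < ε) :
    ∃ δ > 0, ∀ x, ‖x - p‖ < δ →
      inner ℝ ξ (x - p) ≤ ‖ξ‖ * Metric.infDist x S + ε * ‖x - p‖ := by
  -- The estimate is applied at the projection `c` of `x`, at most twice as far from `p` as `x`;
  -- hence the halves of `ε` and `δ`.
  obtain ⟨δ, hδ, H⟩ := exists_inner_le_of_mem_regularNormalCone h (half_pos hε)
  refine ⟨δ / 2, half_pos hδ, fun x hx => ?_⟩
  obtain ⟨c, hc, hcd⟩ := hS.exists_infDist_eq_dist ⟨p, hp⟩ x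
  have h1 : ‖x - c‖ ≤ ‖x - p‖ := by
    rw [← dist_eq_norm, ← dist_eq_norm, ← hcd]
    exact Metric.infDist_le_dist_of_mem hp
  have h2 : ‖c - p‖ ≤ 2 * ‖x - p‖ := by
    calc ‖c - p‖ = ‖(x - p) - (x - c)‖ := by congr 1; abel
      _ ≤ ‖x - p‖ + ‖x - c‖ := norm_sub_le _ _
      _ ≤ _ := by linarith
  have h3 := H c hc (by linarith)
  have h4 : inner ℝ ξ (x - p) = inner ℝ ξ (x - c) + inner ℝ ξ (c - p) := by
    rw [← inner_add_right]; congr 1; abel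
  have h5 := real_inner_le_norm ξ (x - c)
  rw [hcd, dist_eq_norm, h4]
  nlinarith

/-- Smoothing by `τ` makes the norm differentiable at its zero while the gradient factor stays in
the unit ball, so ordinary first-order conditions suffice. -/
theorem hasFDerivAt_sqrt_norm_sq_add (A : X →L[ℝ] V) (b : V) (x : X) {τ : ℝ} (hτ : 0 < τ) :
    HasFDerivAt (fun y => √(‖A y - b‖ ^ 2 + τ ^ 2))
      ((innerSL ℝ ((√(‖A x - b‖ ^ 2 + τ ^ 2))⁻¹ • (A x - b))).comp A) x := by
  have hne : ‖A x - b‖ ^ 2 + τ ^ 2 ≠ 0 := by positivity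
  have h := (((A.hasFDerivAt (x := x)).sub_const b).norm_sq.add_const (τ ^ 2)).sqrt hne
  convert h using 1
  ext d
  simp
  ring

theorem norm_inv_sqrt_smul_le (v : V) (τ : ℝ) : ‖(√(‖v‖ ^ 2 + τ ^ 2))⁻¹ • v‖ ≤ 1 := by
  rw [norm_smul, norm_inv, Real.norm_of_nonneg (Real.sqrt_nonneg _), inv_mul_eq_div]
  exact div_le_one_of_le₀ (Real.le_sqrt_of_sq_le (by nlinarith [sq_nonneg τ])) (Real.sqrt_nonneg _)

/-- A fuzzy multiplier rule for the penalty `L * ‖T x‖`. -/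
theorem exists_approximate_multiplier [FiniteDimensional ℝ X] {S : Set X} (hS : IsClosed S)
    {p η : X} (hp : p ∈ S) (T : X →L[ℝ] V) (hT : T p = 0) {L ε δ : ℝ} (hL : 0 ≤ L) (hε : 0 < ε)
    (hδ : 0 < δ)
    (H : ∀ x ∈ S, ‖x - p‖ < δ → inner ℝ η (x - p) ≤ L * ‖T x‖ + ε * ‖x - p‖)
    {ρ : ℝ} (hρ : 0 < ρ) :
    ∃ x ∈ S, ‖x - p‖ < ρ ∧ ∃ (u : V) (v : X), ‖u‖ ≤ L ∧ ‖v‖ ≤ 2 * ε ∧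
      ∀ d ∈ tangentCone S x, inner ℝ η d ≤ inner ℝ u (T d) + inner ℝ v d := by
  obtain ⟨r, hr, hrlt⟩ := exists_between (lt_min hρ hδ)
  obtain ⟨hrρ, hrδ⟩ := lt_min_iff.1 hrlt
  -- At `p` the smoothing costs `(L + 2 * ε) * τ = r * ε / 2`, too little for a minimizer to reach
  -- the sphere of radius `r`.
  set τ : ℝ := r * ε / (2 * (L + 2 * ε)) with hτdef
  have hLε : 0 < L + 2 * ε := by positivity
  have hτ : 0 < τ := by positivity
  have hτr : (L + 2 * ε) * τ < r * ε := by
    rw [hτdef]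
    field_simp
    linarith [mul_pos hr hε]
  let I : X →L[ℝ] X := ContinuousLinearMap.id ℝ X
  -- `H` uses up one `ε`; the second one makes `φ` grow away from `p` and keeps the minimizer inside
  -- the ball.
  let φ : X → ℝ := fun x => -innerSL ℝ η x + L * √(‖T x - 0‖ ^ 2 + τ ^ 2)
    + 2 * ε * √(‖I x - p‖ ^ 2 + τ ^ 2)
  have hφ : ∀ x, HasFDerivAt φ _ x := fun x =>
    (((innerSL ℝ η).hasFDerivAt (x := x)).neg.add
      ((hasFDerivAt_sqrt_norm_sq_add T 0 x hτ).const_mul L)).add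
      ((hasFDerivAt_sqrt_norm_sq_add I p x hτ).const_mul (2 * ε))
  have hφc : Continuous φ := continuous_iff_continuousAt.2 fun x => (hφ x).continuousAt
  obtain ⟨x, ⟨hxS, hxr⟩, hmin⟩ := ((isCompact_closedBall p r).inter_left hS).exists_isMinOn
    ⟨p, hp, Metric.mem_closedBall_self hr.le⟩ hφc.continuousOn
  rw [mem_closedBall_iff_norm] at hxr
  have hxp : ‖x - p‖ < r := by
    have h1 : φ x ≤ φ p := hmin ⟨hp, Metric.mem_closedBall_self hr.le⟩
    have h2 : φ p = -inner ℝ η p + (L + 2 * ε) * τ := by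
      simp [φ, I, hT, Real.sqrt_sq hτ.le]; ring
    have h3 : ‖T x‖ ≤ √(‖T x - 0‖ ^ 2 + τ ^ 2) :=
      Real.le_sqrt_of_sq_le (by rw [sub_zero]; nlinarith [sq_nonneg τ])
    have h4 : ‖x - p‖ ≤ √(‖I x - p‖ ^ 2 + τ ^ 2) :=
      Real.le_sqrt_of_sq_le (by change _ ≤ ‖x - p‖ ^ 2 + _; nlinarith [sq_nonneg τ])
    have h5 := H x hxS (hxr.trans_lt hrδ)
    rw [inner_sub_right] at h5
    have h6 : -inner ℝ η x + L * ‖T x‖ + 2 * ε * ‖x - p‖ ≤ φ x := by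
      simp only [φ, innerSL_apply_apply]
      gcongr
    have h7 : ε * ‖x - p‖ < ε * r := by linarith
    exact lt_of_mul_lt_mul_left h7 hε.le
  have hloc : IsLocalMinOn φ S x := by
    have hball : Metric.ball p r ∈ 𝓝 x := Metric.isOpen_ball.mem_nhds (mem_ball_iff_norm.2 hxp)
    filter_upwards [self_mem_nhdsWithin, mem_nhdsWithin_of_mem_nhds hball] with y hy hyb
    exact hmin ⟨hy, Metric.ball_subset_closedBall hyb⟩
  refine ⟨x, hxS, hxp.trans hrρ, L • (√(‖T x - 0‖ ^ 2 + τ ^ 2))⁻¹ • (T x - 0),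
    (2 * ε) • (√(‖I x - p‖ ^ 2 + τ ^ 2))⁻¹ • (I x - p), ?_, ?_, fun d hd => ?_⟩
  · rw [norm_smul, Real.norm_of_nonneg hL]
    exact mul_le_of_le_one_right hL (norm_inv_sqrt_smul_le _ _)
  · rw [norm_smul, Real.norm_of_nonneg (by positivity)]
    exact mul_le_of_le_one_right (by positivity) (norm_inv_sqrt_smul_le _ _)
  · have h := hloc.hasFDerivWithinAt_nonneg (hφ x).hasFDerivWithinAt
      (tangentCone_subset_posTangentConeAt S x hd)
    simp only [add_apply, neg_apply,
      smul_apply, ContinuousLinearMap.comp_apply, innerSL_apply_apply,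
      smul_eq_mul] at h
    rw [inner_smul_left _ _ L, inner_smul_left _ _ (2 * ε)]
    simp only [conj_trivial]
    have hI : I d = d := rfl
    rw [hI] at h
    linarith

end NormalCones

/-! ### Euclidean products and their tangent directions. -/

section ProductSpace

@[simp] theorem pair_fst {X Y : Type*} (x : X) (y : Y) : (pair x y).fst = x := rfl

@[simp] theorem pair_snd {X Y : Type*} (x : X) (y : Y) : (pair x y).snd = y := rfl

theorem eprod_ext {X Y : Type*} {p q : X ×ₑ Y} (h₁ : p.fst = q.fst) (h₂ : p.snd = q.snd) :
    p = q :=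
  WithLp.ofLp_injective 2 (Prod.ext h₁ h₂)

variable {X Y : Type*} [NormedAddCommGroup X] [NormedAddCommGroup Y]

theorem norm_fst_le_norm (p : X ×ₑ Y) : ‖p.fst‖ ≤ ‖p‖ :=
  WithLp.norm_fst_le ..

theorem norm_snd_le_norm (p : X ×ₑ Y) : ‖p.snd‖ ≤ ‖p‖ :=
  WithLp.norm_snd_le ..

theorem norm_le_add_norm (p : X ×ₑ Y) : ‖p‖ ≤ ‖p.fst‖ + ‖p.snd‖ := by
  refine le_of_sq_le_sq ?_ (by positivity)
  rw [WithLp.prod_norm_sq_eq_of_L2]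
  nlinarith [norm_nonneg p.fst, norm_nonneg p.snd]

theorem continuous_fst' : Continuous (fun p : X ×ₑ Y => p.fst) := by fun_prop

theorem continuous_snd' : Continuous (fun p : X ×ₑ Y => p.snd) := by fun_prop

theorem continuous_pair : Continuous (fun p : X × Y => pair p.1 p.2) :=
  WithLp.prod_continuous_toLp 2 X Y

theorem tendsto_pair {ι : Type*} {l : Filter ι} {a : ι → X} {b : ι → Y} {x : X} {y : Y}
    (ha : Tendsto a l (𝓝 x)) (hb : Tendsto b l (𝓝 y)) :
    Tendsto (fun i => pair (a i) (b i)) l (𝓝 (pair x y)) :=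
  (continuous_pair.tendsto (x, y)).comp (ha.prodMk_nhds hb)

variable [InnerProductSpace ℝ X] [InnerProductSpace ℝ Y]

@[simp] theorem inner_pair_left (x : X) (y : Y) (p : X ×ₑ Y) :
    inner ℝ (pair x y) p = inner ℝ x p.fst + inner ℝ y p.snd := rfl

theorem pair_mem_tangentCone_left {A : Set X} {B : Set Y} {p : X ×ₑ Y} (hp : p.snd ∈ B) {d : X}
    (hd : d ∈ tangentCone A p.fst) :
    pair d 0 ∈ tangentCone {q : X ×ₑ Y | q.fst ∈ A ∧ q.snd ∈ B} p := by
  obtain ⟨u, t, hu, ht, hux, ht0, hd⟩ := hd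
  refine ⟨fun k => pair (u k) p.snd, t, fun k => ⟨hu k, hp⟩, ht,
    tendsto_pair hux tendsto_const_nhds, ht0, ?_⟩
  refine (tendsto_pair hd tendsto_const_nhds).congr fun k => eprod_ext ?_ ?_ <;> simp

theorem pair_mem_tangentCone_right {A : Set X} {B : Set Y} {p : X ×ₑ Y} (hp : p.fst ∈ A) {d : Y}
    (hd : d ∈ tangentCone B p.snd) :
    pair 0 d ∈ tangentCone {q : X ×ₑ Y | q.fst ∈ A ∧ q.snd ∈ B} p := by
  obtain ⟨u, t, hu, ht, hux, ht0, hd⟩ := hd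
  refine ⟨fun k => pair p.fst (u k), t, fun k => ⟨hp, hu k⟩, ht,
    tendsto_pair tendsto_const_nhds hux, ht0, ?_⟩
  refine (tendsto_pair tendsto_const_nhds hd).congr fun k => eprod_ext ?_ ?_ <;> simp

end ProductSpace

/-! ### Splitting normals to the graph of the constraint map. -/

section Multipliers

variable {X Y W : Type*} [NormedAddCommGroup X] [NormedAddCommGroup Y] [NormedAddCommGroup W]
  {F : X → Set Y} {G : X ×ₑ Y → Set W}

theorem mem_inv_feasibilityMap_zero {p : X ×ₑ W ×ₑ X ×ₑ Y} :
    p ∈ inv (feasibilityMap F G) 0 ↔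
      p.fst = p.snd.snd.fst ∧ p.snd.snd.snd ∈ F p.fst ∧ p.snd.fst ∈ G p.snd.snd := by
  constructor
  · rintro ⟨y, hy, g, hg, h⟩
    have h1 : p.fst - p.snd.snd.fst = 0 := (congrArg WithLp.fst h).symm
    have h2 : y - p.snd.snd.snd = 0 := (congrArg (fun r => r.snd.fst) h).symm
    have h3 : g - p.snd.fst = 0 := (congrArg (fun r => r.snd.snd) h).symm
    rw [sub_eq_zero] at h1 h2 h3
    subst h2 h3
    exact ⟨h1, hy, hg⟩
  · rintro ⟨h1, h2, h3⟩
    refine ⟨_, h2, _, h3, ?_⟩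
    rw [h1, sub_self, sub_self, sub_self]
    rfl

theorem isClosed_inv_feasibilityMap_zero (hF : IsClosed (gph F)) (hG : IsClosed (gph G)) :
    IsClosed (inv (feasibilityMap F G) 0) := by
  have : inv (feasibilityMap F G) 0 = {p | p.fst = p.snd.snd.fst} ∩
      ((fun p => pair p.fst p.snd.snd.snd) ⁻¹' gph F ∩
        (fun p => pair p.snd.snd p.snd.fst) ⁻¹' gph G) := by
    ext p
    exact mem_inv_feasibilityMap_zero
  rw [this]
  refine (isClosed_eq (by fun_prop) (by fun_prop)).inter ((hF.preimage ?_).inter (hG.preimage ?_))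
  · exact continuous_pair.comp (by fun_prop : Continuous
      fun p : X ×ₑ W ×ₑ X ×ₑ Y => (p.fst, p.snd.snd.snd))
  · exact continuous_pair.comp (by fun_prop : Continuous
      fun p : X ×ₑ W ×ₑ X ×ₑ Y => (p.snd.snd, p.snd.fst))

theorem infDist_inv_feasibilityMap_le {κ : NNReal} {x : X ×ₑ W ×ₑ X ×ₑ Y}
    (hx : Metric.infEDist x (inv (feasibilityMap F G) 0) ≤
      (κ : ENNReal) * Metric.infEDist 0 (feasibilityMap F G x))
    {y : Y} (hy : y ∈ F x.fst) (hw : x.snd.fst ∈ G x.snd.snd) :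
    Metric.infDist x (inv (feasibilityMap F G) 0) ≤ κ * ‖pair x.fst y - x.snd.snd‖ := by
  -- Choosing `g = w` makes the last residual vanish; only the mismatch remains.
  set r : X ×ₑ Y ×ₑ W := pair (x.fst - x.snd.snd.fst) (pair (y - x.snd.snd.snd) 0) with hr
  have hrm : r ∈ feasibilityMap F G x := ⟨y, hy, x.snd.fst, hw, by rw [sub_self]⟩
  have hnorm : ‖r‖ = ‖pair x.fst y - x.snd.snd‖ := by
    rw [← sq_eq_sq₀ (norm_nonneg _) (norm_nonneg _), WithLp.prod_norm_sq_eq_of_L2,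
      WithLp.prod_norm_sq_eq_of_L2 r.snd, WithLp.prod_norm_sq_eq_of_L2 (pair x.fst y - x.snd.snd)]
    simp [hr]
  have h1 : Metric.infEDist x (inv (feasibilityMap F G) 0) ≤ ENNReal.ofReal (κ * ‖r‖) := by
    refine hx.trans ?_
    rw [ENNReal.ofReal_mul κ.coe_nonneg, ENNReal.ofReal_coe_nnreal]
    gcongr
    refine (Metric.infEDist_le_edist_of_mem hrm).trans_eq ?_
    rw [edist_dist, dist_zero_left]
  rw [← hnorm]
  exact ENNReal.toReal_le_of_le_ofReal (by positivity) h1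

variable [InnerProductSpace ℝ X] [InnerProductSpace ℝ Y] [InnerProductSpace ℝ W]

/-- Regular normals to the graph of the constraint map lift to the zero set of the feasibility
mapping. -/
theorem lift_mem_regularNormalCone {z ξ : X} {w ω : W} {q : X ×ₑ Y}
    (h : pair ξ ω ∈ regularNormalCone (gph (constraintMap F G)) (pair z w)) :
    pair ξ (pair ω 0) ∈ regularNormalCone (inv (feasibilityMap F G) 0) (pair z (pair w q)) := by
  rintro d ⟨u, t, hu, ht, hup, ht0, hd⟩
  -- Dropping the last block maps the zero set into the graph of `H`, and hence tangents to
  -- tangents.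
  have hmem : pair d.fst d.snd.fst ∈ tangentCone (gph (constraintMap F G)) (pair z w) := by
    refine ⟨fun k => pair (u k).fst (u k).snd.fst, t, fun k => ?_, ht, ?_, ht0, ?_⟩
    · obtain ⟨h1, h2, h3⟩ := mem_inv_feasibilityMap_zero.1 (hu k)
      refine Set.mem_iUnion₂.2 ⟨_, h2, ?_⟩
      change _ ∈ G (pair (u k).fst (u k).snd.snd.snd)
      rw [h1]
      exact h3
    · exact tendsto_pair ((continuous_fst'.tendsto _).comp hup)
        ((continuous_fst'.tendsto _).comp ((continuous_snd'.tendsto _).comp hup))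
    · exact tendsto_pair ((continuous_fst'.tendsto _).comp hd)
        ((continuous_fst'.tendsto _).comp ((continuous_snd'.tendsto _).comp hd))
  simpa using h _ hmem

variable [FiniteDimensional ℝ X] [FiniteDimensional ℝ Y] [FiniteDimensional ℝ W]

/-- A fuzzy chain rule for regular normals to the graph of the constraint map. -/
theorem exists_approximate_normals (hF : IsClosed (gph F)) (hG : IsClosed (gph G))
    {z ξ : X} {w ω : W} {l : Y} (hl : l ∈ F z) (hw : w ∈ G (pair z l))
    (h : pair ξ ω ∈ regularNormalCone (gph (constraintMap F G)) (pair z w))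
    {κ : NNReal} (hκ : ∀ᶠ x in 𝓝 (pair z (pair w (pair z l))),
      Metric.infEDist x (inv (feasibilityMap F G) 0) ≤
        (κ : ENNReal) * Metric.infEDist 0 (feasibilityMap F G x))
    {ρ : ℝ} (hρ : 0 < ρ) :
    ∃ a ∈ gph F, ∃ b ∈ gph G, ∃ (u v : X ×ₑ Y) (v' : (X ×ₑ Y) ×ₑ W),
      ‖a - pair z l‖ < ρ ∧ ‖b - pair (pair z l) w‖ < ρ ∧
      ‖u‖ ≤ κ * ‖pair ξ ω‖ ∧ ‖v‖ ≤ ρ ∧ ‖v'‖ ≤ ρ ∧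
      pair ξ 0 - u - v ∈ regularNormalCone (gph F) a ∧
      pair u ω - v' ∈ regularNormalCone (gph G) b := by
  set p : X ×ₑ W ×ₑ X ×ₑ Y := pair z (pair w (pair z l)) with hp
  have hpC : p ∈ inv (feasibilityMap F G) 0 := mem_inv_feasibilityMap_zero.2 ⟨rfl, hl, hw⟩
  obtain ⟨δ₁, hδ₁, H₁⟩ := exists_inner_le_infDist_of_mem_regularNormalCone
    (isClosed_inv_feasibilityMap_zero hF hG) hpC (lift_mem_regularNormalCone h)
    (show 0 < ρ / 6 by positivity)
  obtain ⟨δ₂, hδ₂, H₂⟩ := Metric.eventually_nhds_iff.1 hκ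
  set S : Set ((X ×ₑ Y) ×ₑ (X ×ₑ Y) ×ₑ W) := {x | x.fst ∈ gph F ∧ x.snd ∈ gph G} with hS
  set P : (X ×ₑ Y) ×ₑ (X ×ₑ Y) ×ₑ W := pair (pair z l) (pair (pair z l) w) with hP
  have hSc : IsClosed S := (hF.preimage continuous_fst').inter (hG.preimage continuous_snd')
  let T : (X ×ₑ Y) ×ₑ (X ×ₑ Y) ×ₑ W →L[ℝ] X ×ₑ Y :=
    WithLp.fstL 2 ℝ _ _ - (WithLp.fstL 2 ℝ _ _).comp (WithLp.sndL 2 ℝ _ _)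
  have hTapp : ∀ x, T x = x.fst - x.snd.fst := fun x => rfl
  have hnorm : ‖pair ξ (pair ω (0 : X ×ₑ Y))‖ = ‖pair ξ ω‖ := by
    rw [← sq_eq_sq₀ (norm_nonneg _) (norm_nonneg _), WithLp.prod_norm_sq_eq_of_L2,
      WithLp.prod_norm_sq_eq_of_L2 (pair ξ ω), pair_snd, WithLp.prod_norm_sq_eq_of_L2]
    simp
  -- Regrouping coordinates costs a factor 3 in norm, so `ρ / 6` becomes `ε = ρ / 2`, and the error
  -- bound `2 * ε` is `ρ`.
  obtain ⟨x, ⟨hxF, hxG⟩, hxP, u, v, hu, hv, hd⟩ := exists_approximate_multiplier hSc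
    (p := P) (η := pair (pair ξ 0) (pair 0 ω)) ⟨hl, hw⟩ T (by simp [hTapp, hP])
    (L := κ * ‖pair ξ ω‖) (ε := ρ / 2) (δ := min δ₁ δ₂ / 3) (by positivity) (by positivity)
    (by positivity) (fun x hx hxδ => by
      set x' : X ×ₑ W ×ₑ X ×ₑ Y := pair x.fst.fst (pair x.snd.snd x.snd.fst) with hx'
      have h1 : ‖x' - p‖ ≤ 3 * ‖x - P‖ := by
        have e1 := norm_le_add_norm (x' - p)
        have e2 := norm_le_add_norm (x' - p).snd
        have e3 : ‖(x' - p).fst‖ ≤ ‖x - P‖ :=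
          (norm_fst_le_norm (x - P).fst).trans (norm_fst_le_norm _)
        have e4 : ‖(x' - p).snd.fst‖ ≤ ‖x - P‖ :=
          (norm_snd_le_norm (x - P).snd).trans (norm_snd_le_norm _)
        have e5 : ‖(x' - p).snd.snd‖ ≤ ‖x - P‖ :=
          (norm_fst_le_norm (x - P).snd).trans (norm_snd_le_norm _)
        linarith
      have hlt : ‖x' - p‖ < min δ₁ δ₂ := by linarith
      have h2 := H₁ x' (hlt.trans_le (min_le_left _ _))
      have h3 := infDist_inv_feasibilityMap_le (x := x') (y := x.fst.snd)
        (H₂ (by rw [dist_eq_norm]; exact hlt.trans_le (min_le_right _ _))) hx.1 hx.2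
      have h4 : inner ℝ (pair (pair ξ (0 : Y)) (pair (0 : X ×ₑ Y) ω)) (x - P) =
          inner ℝ (pair ξ (pair ω (0 : X ×ₑ Y))) (x' - p) := by
        simp [hx', hp, hP]
      have h5 : ‖pair ξ ω‖ * Metric.infDist x' (inv (feasibilityMap F G) 0) ≤
          ‖pair ξ ω‖ * (κ * ‖T x‖) := mul_le_mul_of_nonneg_left h3 (norm_nonneg _)
      rw [h4]
      rw [hnorm] at h2
      nlinarith) hρ
  refine ⟨x.fst, hxF, x.snd, hxG, u, v.fst, v.snd, (norm_fst_le_norm (x - P)).trans_lt hxP,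
    (norm_snd_le_norm (x - P)).trans_lt hxP, hu, (norm_fst_le_norm v).trans (by linarith),
    (norm_snd_le_norm v).trans (by linarith), fun d hdF => ?_, fun d hdG => ?_⟩
  -- `T` is a difference, so `u` enters with opposite signs when the two factors are tested
  -- separately.
  · have h1 := hd _ (pair_mem_tangentCone_left hxG hdF)
    rw [hTapp, real_inner_comm (pair d 0) v] at h1
    simp only [inner_pair_left, pair_fst, pair_snd, WithLp.zero_fst, sub_zero,
      inner_zero_left, inner_zero_right, add_zero] at h1
    rw [inner_sub_left, inner_sub_left, inner_pair_left, inner_zero_left, add_zero,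
      real_inner_comm d v.fst]
    linarith
  · have h1 := hd _ (pair_mem_tangentCone_right hxF hdG)
    rw [hTapp, real_inner_comm (pair 0 d) v] at h1
    simp only [inner_pair_left, pair_fst, pair_snd, zero_sub,
      inner_zero_left, inner_zero_right, zero_add, inner_neg_right] at h1
    rw [inner_sub_left, inner_pair_left, real_inner_comm d v.snd]
    linarith

/-- Only the nearby `v k` need be normals; `v'` carries the limit. -/
theorem limit_mem_limitingNormalCone {E : Type*} [NormedAddCommGroup E] [InnerProductSpace ℝ E]
    {S : Set E} {x ξ : E} {u v v' : ℕ → E} {r : ℕ → ℝ} (hu : ∀ k, u k ∈ S)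
    (hux : ∀ k, ‖u k - x‖ ≤ r k) (hvv' : ∀ k, ‖v k - v' k‖ ≤ r k) (hr : Tendsto r atTop (𝓝 0))
    (hv' : Tendsto v' atTop (𝓝 ξ)) (hv : ∀ k, v k ∈ regularNormalCone S (u k)) :
    ξ ∈ limitingNormalCone S x := by
  refine ⟨u, v, hu, tendsto_iff_norm_sub_tendsto_zero.2
    (squeeze_zero (fun _ => norm_nonneg _) hux hr), ?_, hv⟩
  have : Tendsto (fun k => v k - v' k) atTop (𝓝 0) := squeeze_zero_norm hvv' hr
  simpa using this.add hv'

/-- Limiting normals to the graph of the constraint map split into limiting normals to the graphs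
of `F` and `G`. -/
theorem exists_multiplier (hF : IsClosed (gph F)) (hG : IsClosed (gph G)) {z ξ : X} {ω : W}
    (h : pair ξ ω ∈ limitingNormalCone (gph (constraintMap F G)) (pair z 0))
    (hsemi : InnerSemicompactAt (intermediateMap F G) (pair z 0) (dom (intermediateMap F G)))
    (hsub : ∀ l ∈ multiplierMap F G z,
      MetricallySubregularAt (feasibilityMap F G) (pair z (pair 0 (pair z l))) 0) :
    ∃ l ∈ multiplierMap F G z, ∃ u : X ×ₑ Y,
      pair ξ 0 - u ∈ limitingNormalCone (gph F) (pair z l) ∧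
      pair u ω ∈ limitingNormalCone (gph G) (pair (pair z l) 0) := by
  obtain ⟨p, η, hp, hpz, hη, hN⟩ := h
  obtain ⟨φ, y, y₀, hφ, hy, hyk⟩ := hsemi p (fun k => by
    obtain ⟨l, hl, hw⟩ := Set.mem_iUnion₂.1 (hp k)
    exact ⟨_, l, hl, hw, rfl⟩) hpz
  choose l hl hw hyl using hyk
  have hpφ := hpz.comp hφ.tendsto_atTop
  have hηφ := hη.comp hφ.tendsto_atTop
  have hzlim : Tendsto (fun k => (p (φ k)).fst) atTop (𝓝 z) := (continuous_fst'.tendsto _).comp hpφ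
  have hwlim : Tendsto (fun k => (p (φ k)).snd) atTop (𝓝 0) := (continuous_snd'.tendsto _).comp hpφ
  have hyz : y₀.fst = z := by
    refine tendsto_nhds_unique ((continuous_fst'.tendsto _).comp hy) (hzlim.congr fun k => ?_)
    rw [Function.comp, hyl k]
    rfl
  obtain ⟨l₀, rfl⟩ : ∃ l₀, y₀ = pair z l₀ := ⟨y₀.snd, eprod_ext hyz rfl⟩
  have hlF : l₀ ∈ F z := hF.mem_of_tendsto (x := pair z l₀) hy
    (Eventually.of_forall fun k => by rw [hyl k]; exact hl k)
  have hlG : 0 ∈ G (pair z l₀) := hG.mem_of_tendsto (tendsto_pair hy hwlim)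
    (Eventually.of_forall fun k => by rw [hyl k]; exact hw k)
  obtain ⟨κ, -, U, hU, hκ⟩ := hsub l₀ ⟨hlF, hlG⟩
  -- The constant `κ` belongs to the limit point `l₀`, but its neighborhood also surrounds late
  -- points of the sequence, so one `κ` bounds all `u`.
  have hUlim : ∀ᶠ k in atTop, U ∈ 𝓝 (pair (p (φ k)).fst (pair (p (φ k)).snd (y k))) :=
    (tendsto_pair hzlim (tendsto_pair hwlim hy)).eventually (eventually_mem_nhds_iff.2 hU)
  have key : ∀ k : ℕ, ∃ (a : X ×ₑ Y) (b : (X ×ₑ Y) ×ₑ W) (u α : X ×ₑ Y) (β : (X ×ₑ Y) ×ₑ W),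
      a ∈ gph F ∧ b ∈ gph G ∧ u ∈ Metric.closedBall 0 (κ * (‖pair ξ ω‖ + 1)) ∧
      ‖a - pair z l₀‖ ≤ 2 * (1 / ((k : ℝ) + 1)) ∧
      ‖b - pair (pair z l₀) 0‖ ≤ 2 * (1 / ((k : ℝ) + 1)) ∧
      ‖α - (pair ξ 0 - u)‖ ≤ 2 * (1 / ((k : ℝ) + 1)) ∧
      ‖β - pair u ω‖ ≤ 2 * (1 / ((k : ℝ) + 1)) ∧
      α ∈ regularNormalCone (gph F) a ∧ β ∈ regularNormalCone (gph G) b := by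
    intro k
    have hρ : 0 < 1 / ((k : ℝ) + 1) := Nat.one_div_pos_of_nat
    have hρ1 : 1 / ((k : ℝ) + 1) ≤ 1 := by
      rw [div_le_one (by positivity)]; linarith [k.cast_nonneg (α := ℝ)]
    set ρ := 1 / ((k : ℝ) + 1)
    obtain ⟨j, hjU, hjη, hjy⟩ := (hUlim.and ((Metric.tendsto_nhds.1 hηφ ρ hρ).and
      (Metric.tendsto_nhds.1 (tendsto_pair hy hwlim) ρ hρ))).exists
    rw [dist_eq_norm] at hjη hjy
    rw [hyl j] at hjU hjy
    obtain ⟨a, ha, b, hb, u, v, v', h1, h2, h3, h4, h5, h6, h7⟩ :=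
      exists_approximate_normals (ξ := (η (φ j)).fst) (ω := (η (φ j)).snd) hF hG (hl j) (hw j) (hN (φ j))
        (Filter.mem_of_superset hjU fun x hx => hκ x hx) hρ
    have hη1 : ‖(η (φ j)).fst - ξ‖ < ρ := (norm_fst_le_norm _).trans_lt hjη
    have hη2 : ‖(η (φ j)).snd - ω‖ < ρ := (norm_snd_le_norm _).trans_lt hjη
    have hηn : ‖η (φ j)‖ ≤ ‖pair ξ ω‖ + 1 := by
      have := norm_le_norm_add_norm_sub' (η (φ j)) (pair ξ ω)
      have h8 : ‖η (φ j) - pair ξ ω‖ < ρ := hjη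
      linarith
    refine ⟨a, b, u, _, _, ha, hb, ?_, ?_, ?_, ?_, ?_, h6, h7⟩
    · rw [mem_closedBall_zero_iff]
      exact h3.trans (mul_le_mul_of_nonneg_left hηn κ.2)
    · refine (norm_sub_le_norm_sub_add_norm_sub _ (pair (p (φ j)).fst (l j)) _).trans ?_
      have := (norm_fst_le_norm _).trans_lt hjy
      rw [two_mul]
      exact add_le_add h1.le this.le
    · refine (norm_sub_le_norm_sub_add_norm_sub _
        (pair (pair (p (φ j)).fst (l j)) (p (φ j)).snd) _).trans ?_
      rw [two_mul]
      exact add_le_add h2.le hjy.le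
    · have e : pair (η (φ j)).fst 0 - u - v - (pair ξ 0 - u)
          = pair ((η (φ j)).fst - ξ) (0 : Y) - v := by
        refine eprod_ext ?_ ?_ <;> simp <;> abel
      have e2 := norm_le_add_norm (pair ((η (φ j)).fst - ξ) (0 : Y))
      rw [pair_fst, pair_snd, norm_zero] at e2
      rw [e]
      linarith [norm_sub_le (pair ((η (φ j)).fst - ξ) (0 : Y)) v]
    · have e : pair u (η (φ j)).snd - v' - pair u ω
          = pair (0 : X ×ₑ Y) ((η (φ j)).snd - ω) - v' := by
        refine eprod_ext ?_ ?_
        · simp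
        · simp; abel
      have e2 := norm_le_add_norm (pair (0 : X ×ₑ Y) ((η (φ j)).snd - ω))
      rw [pair_fst, pair_snd, norm_zero] at e2
      rw [e]
      linarith [norm_sub_le (pair (0 : X ×ₑ Y) ((η (φ j)).snd - ω)) v']
  choose a b u α β ha hb hu haz hbz hα hβ hαN hβN using key
  obtain ⟨u₀, -, ψ, hψ, hu₀⟩ := (isCompact_closedBall _ _).tendsto_subseq hu
  have hr : Tendsto (fun k => 2 * (1 / ((ψ k : ℝ) + 1))) atTop (𝓝 0) := by
    simpa using (tendsto_one_div_add_atTop_nhds_zero_nat.comp hψ.tendsto_atTop).const_mul (2 : ℝ)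
  exact ⟨l₀, ⟨hlF, hlG⟩, u₀,
    limit_mem_limitingNormalCone (fun k => ha (ψ k)) (fun k => haz (ψ k)) (fun k => hα (ψ k)) hr
      (tendsto_const_nhds.sub hu₀) (fun k => hαN (ψ k)),
    limit_mem_limitingNormalCone (fun k => hb (ψ k)) (fun k => hbz (ψ k)) (fun k => hβ (ψ k)) hr
      (tendsto_pair hu₀ tendsto_const_nhds) (fun k => hβN (ψ k))⟩

end Multipliers

end ImplicitVar

theorem proposition4p13 (n m s : ℕ)
    (f : EuclideanSpace ℝ (Fin n) → ℝ) (hf : LocallyLipschitz f)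
    (F : EuclideanSpace ℝ (Fin n) → Set (EuclideanSpace ℝ (Fin m)))
    (hF : IsClosed (ImplicitVar.gph F))
    (G : EuclideanSpace ℝ (Fin n) ×ₑ EuclideanSpace ℝ (Fin m) → Set (EuclideanSpace ℝ (Fin s)))
    (hG : IsClosed (ImplicitVar.gph G))
    (M : Set (EuclideanSpace ℝ (Fin n))) (hM : IsClosed M)
    (z : EuclideanSpace ℝ (Fin n))
    (hz : ImplicitVar.ImplicitlyMStationary f F G M z)
    (hsemi : ImplicitVar.InnerSemicompactAt (ImplicitVar.intermediateMap F G)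
      (ImplicitVar.pair z 0) (ImplicitVar.dom (ImplicitVar.intermediateMap F G)))
    (hsub : ∀ l ∈ ImplicitVar.multiplierMap F G z,
      ImplicitVar.MetricallySubregularAt (ImplicitVar.feasibilityMap F G)
        (ImplicitVar.pair z (ImplicitVar.pair 0 (ImplicitVar.pair z l))) 0) :
    ImplicitVar.ExplicitlyMStationary f F G M z := by
  obtain ⟨hfeas, ν, hν⟩ := hz
  obtain ⟨_, ⟨c, hc, ξ, hξ, rfl⟩, b, hb, hsum⟩ := hν
  obtain ⟨l, hl, u, hu₁, hu₂⟩ := ImplicitVar.exists_multiplier hF hG hξ hsemi hsub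
  -- The second block of `(ξ, 0) - u` is `-u.snd`, which makes `u.snd` the multiplier `μ`.
  refine ⟨hfeas, l, hl, u.snd, ν, ?_⟩
  have hdec : ξ - u.fst ∈ ImplicitVar.coderivative F z l u.snd := by
    have e : ImplicitVar.pair (ξ - u.fst) (-u.snd) = ImplicitVar.pair ξ 0 - u :=
      ImplicitVar.eprod_ext (by simp) (by simp)
    rw [← e] at hu₁
    exact hu₁
  refine ⟨_, ⟨_, ⟨c, hc, _, hdec, rfl⟩, u.fst, hu₂, rfl⟩, b, hb, ?_⟩
  rw [← hsum]
  simp only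
  abel
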